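/- Let $\mathbb{Q}=(\mathbb{Q},\wedge,\vee,\cdot,\to,1,0)$ be a commutative integral quantale with $0\neq 1$: a complete lattice (a set) with least element $0$ and greatest element $1$, such that $(\mathbb{Q},\cdot,1)$ is a commutative monoid, $x\cdot\bigvee_i y_i=\bigvee_i (x\cdot y_i)$ for all families, and $x\to y:=\bigvee\{z: x\cdot z\le y\}$. The $\mathbb{Q}$-valued universe is $V^{\mathbb{Q}}=\bigcup_{\alpha}V^{\mathbb{Q}}_\alpha$, where $V_0^{\mathbb{Q}}=\emptyset$, $V_{\alpha+1}^{\mathbb{Q}}$ is the set of all functions $f$ with $\mathrm{dom}(f)\subseteq V_\alpha^{\mathbb{Q}}$ and $\mathrm{ran}(f)\subseteq\mathbb{Q}$, and unions are taken at limit ordinals. For $f,g\in V^{\mathbb{Q}}$ put, by recursion, $$[\![f\subseteq g]\!]=\bigwedge_{x\in \mathrm{dom}(f)}\bigl(f(x)\to[\![x\in g]\!]\bigr),\qquad [\![f=g]\!]=[\![f\subseteq g]\!]\cdot[\![g\subseteq f]\!],\qquad [\![f\in g]\!]=\bigvee_{x\in \mathrm{dom}(g)}\bigl(g(x)\cdot[\![x=f]\!]\bigr).$$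 For $M\subseteq V^{\mathbb{Q}}$ and a first-order formula $\varphi$ in the language $\{\in\}$ with equality (connectives $\bot,\wedge,\vee,\to$, with $\neg\varphi:=\varphi\to\bot$, and quantifiers $\forall,\exists$) with parameters from $M$, the value $[\![\varphi]\!]_M\in\mathbb{Q}$ is obtained from these values of the atomic formulas by interpreting $\bot,\wedge,\vee,\to$ as $0,\wedge,\vee,\to$ of $\mathbb{Q}$, and $\forall,\exists$ as meets and joins over $M$. Let $\mathrm{Def}^{\mathbb{Q}}(M)$ be the set of all $f\in V^{\mathbb{Q}}$ with $\mathrm{dom}(f)=M$ for which there are a formula $\varphi(x,\bar y)$ and parameters $\bar b$ from $M$ with $f(a)=[\![\varphi(a,\bar b)]\!]_M$ for all $a\in M$. Let $\mathbb{L}^{\mathbb{Q}}_0=\emptyset$, $\mathbb{L}^{\mathbb{Q}}_{\alpha+1}=\mathrm{Def}^{\mathbb{Q}}(\mathbb{L}^{\mathbb{Q}}_\alpha)\cup\mathbb{L}^{\mathbb{Q}}_\alpha$, $\mathbb{L}^{\mathbb{Q}}_\alpha=\bigcup_{\beta<\alpha}\mathbb{L}^{\mathbb{Q}}_\beta$ for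 limit $\alpha$, and $\mathbb{L}^{\mathbb{Q}}=\bigcup_\alpha\mathbb{L}^{\mathbb{Q}}_\alpha$. Let $L=\bigcup_\alpha L_\alpha$ be Gödel's constructible universe with its usual levels $L_\alpha$. **Theorem.** There is a class function $j:L\to\mathbb{L}^{\mathbb{Q}}$ such that for every ordinal $\alpha$: 1. $j(X)\in\mathbb{L}^{\mathbb{Q}}_\alpha$ for all $X\in L_\alpha$; 2. $j\restriction_{L_\alpha}$ is injective; 3. for every $Y\in\mathbb{L}^{\mathbb{Q}}_\alpha$ there is $X\in L_\alpha$ with $[\![j(X)=Y]\!]=1$; 4. for every formula $\varphi(x_1,\dots,x_n)$ as above and all $a_1,\dots,a_n\in L_\alpha$, $$L_\alpha\models\varphi(a_1,\dots,a_n)\iff[\![\varphi(j(a_1),\dots,j(a_n))]\!]_{\mathbb{L}^{\mathbb{Q}}_\alpha}=1.$$ -/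

import Mathlib

open Quantale

universe u

/-! ## Commutative integral quantales -/

/-- A commutative integral quantale: a complete lattice with a commutative monoid structure whose
product distributes over arbitrary joins and whose unit `1` is the top element. The bottom
element `0` is `⊥`, and the residual `x → y`, the join of all `z` with `x * z ≤ y`, is
Mathlib's `x ⇨ᵣ y`. -/
class CommIntegralQuantale (Q : Type u) extends CommMonoid Q, CompleteLattice Q, IsQuantale Q where
  one_eq_top : (1 : Q) = ⊤

/-! ## Formulas and classical satisfaction -/

/-- Formulas of first-order logic in the language `{∈}` with equality, with free variables among
`n` variables indexed by `Fin n`. The quantifiers bind the variable with index `0` and shift the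
others by one. Since truth values in a quantale will be assigned to them, all connectives other
than negation are primitive; `¬ φ` is `φ → ⊥`. -/
inductive SetFormula : ℕ → Type
  | falsum {n : ℕ} : SetFormula n
  | eq {n : ℕ} (i j : Fin n) : SetFormula n
  | mem {n : ℕ} (i j : Fin n) : SetFormula n
  | and {n : ℕ} (φ ψ : SetFormula n) : SetFormula n
  | or {n : ℕ} (φ ψ : SetFormula n) : SetFormula n
  | imp {n : ℕ} (φ ψ : SetFormula n) : SetFormula n
  | all {n : ℕ} (φ : SetFormula (n + 1)) : SetFormula n
  | ex {n : ℕ} (φ : SetFormula (n + 1)) : SetFormula n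

/-- `M ⊨ φ(a)`: classical satisfaction in the structure `(M, ∈)`, for a class `M` of sets. -/
def Satisfies (M : Set ZFSet.{u}) : {n : ℕ} → SetFormula n → (Fin n → ZFSet.{u}) → Prop
  | _, .falsum, _ => False
  | _, .eq i j, a => a i = a j
  | _, .mem i j, a => a i ∈ a j
  | _, .and φ ψ, a => Satisfies M φ a ∧ Satisfies M ψ a
  | _, .or φ ψ, a => Satisfies M φ a ∨ Satisfies M ψ a
  | _, .imp φ ψ, a => Satisfies M φ a → Satisfies M ψ a
  | _, .all φ, a => ∀ x ∈ M, Satisfies M φ (Fin.cons x a)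
  | _, .ex φ, a => ∃ x ∈ M, Satisfies M φ (Fin.cons x a)

/-! ## Gödel's constructible universe -/

/-- `Def(M)`: the sets `{z ∈ M : M ⊨ φ(z, b)}` for a formula `φ` and parameters `b` from `M`. -/
def definableSubsets (M : Set ZFSet.{u}) : Set ZFSet.{u} :=
  {x | ∃ (n : ℕ) (φ : SetFormula (n + 1)) (b : Fin n → ZFSet.{u}), (∀ i, b i ∈ M) ∧
    ∀ z, z ∈ x ↔ z ∈ M ∧ Satisfies M φ (Fin.cons z b)}

/-- The levels of the constructible hierarchy: `L_0 = ∅`, `L_{α+1} = Def(L_α)`, and unions at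
limits. -/
noncomputable def constructibleLevel (α : Ordinal.{u}) : Set ZFSet.{u} :=
  Ordinal.limitRecOn (motive := fun _ => Set ZFSet.{u}) α ∅ (fun _ M => definableSubsets M)
    (fun α _ M => ⋃ (β : Ordinal.{u}) (h : β < α), M β h)

/-- Gödel's constructible universe `L`. -/
noncomputable def constructibleUniverse : Set ZFSet.{u} :=
  ⋃ α : Ordinal.{u}, constructibleLevel α

/-! ## The quantale-valued universe

The truth values form a type `Q : Type u`. As the elements of the valued universe are functions in
the sense of set theory, i.e. sets of ordered pairs, the truth values have to be sets as well:
`c : Q ↪ ZFSet` is an injective identification of the truth values with sets. Thus, for a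
function `f` with values in `Q`, `f(x) = q` means that the pair `(x, c q)` is in `f`. -/

section Valued

variable {Q : Type u} (c : Q ↪ ZFSet.{u})

/-- The set of truth values. -/
noncomputable def truthValues : ZFSet.{u} := ZFSet.range c

/-- The domain of a function (a set of ordered pairs). -/
def funDomain (f : ZFSet.{u}) : Set ZFSet.{u} := {x | ∃ y, ZFSet.pair x y ∈ f}

/-- The levels of the `Q`-valued universe: `V_0 = ∅`, `V_{α+1}` consists of the functions `f`
with `dom f ⊆ V_α` and `ran f ⊆ Q`, and unions are taken at limits. -/
noncomputable def valuedLevel (α : Ordinal.{u}) : Set ZFSet.{u} :=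
  Ordinal.limitRecOn (motive := fun _ => Set ZFSet.{u}) α ∅
    (fun _ M => {f | ∃ d : ZFSet.{u}, (∀ x ∈ d, x ∈ M) ∧ ZFSet.IsFunc d (truthValues c) f})
    (fun α _ M => ⋃ (β : Ordinal.{u}) (h : β < α), M β h)

/-- The `Q`-valued universe `V^Q`. -/
noncomputable def valuedUniverse : Set ZFSet.{u} := ⋃ α : Ordinal.{u}, valuedLevel c α

theorem rank_lt_of_pair_mem {x y f : ZFSet.{u}} (h : ZFSet.pair x y ∈ f) : x.rank < f.rank := by
  have h1 : ({x} : ZFSet.{u}) ∈ ZFSet.pair x y := by simp [ZFSet.pair]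
  have h2 : x ∈ ({x} : ZFSet.{u}) := by simp
  exact (ZFSet.rank_lt_of_mem h2).trans
    ((ZFSet.rank_lt_of_mem h1).trans (ZFSet.rank_lt_of_mem h))

/-- The lexicographic measure by which the recursion defining `⟦f ⊆ g⟧`, `⟦f = g⟧` and `⟦f ∈ g⟧`
terminates. It is symmetric in `f` and `g`. -/
noncomputable def valMeasure (f g : ZFSet.{u}) (t : ℕ) : Ordinal.{u} ×ₗ Ordinal.{u} ×ₗ ℕ :=
  toLex (max f.rank g.rank, toLex (min f.rank g.rank, t))

theorem valMeasure_comm (f g : ZFSet.{u}) (t : ℕ) : valMeasure f g t = valMeasure g f t := by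
  simp only [valMeasure, max_comm, min_comm]

theorem valMeasure_lt {x f : ZFSet.{u}} (g : ZFSet.{u}) (s t : ℕ) (h : x.rank < f.rank) :
    valMeasure x g s < valMeasure f g t := by
  simp only [valMeasure, Prod.Lex.toLex_lt_toLex]
  rcases lt_or_ge g.rank f.rank with h1 | h1
  · left
    rw [max_eq_left h1.le]
    exact max_lt h h1
  · right
    rw [max_eq_right h1, min_eq_left h1, max_eq_right (h.le.trans h1),
      min_eq_left (h.le.trans h1)]
    exact ⟨rfl, Or.inl h⟩

theorem valMeasure_lt_tag (f g : ZFSet.{u}) : valMeasure f g 0 < valMeasure f g 1 := by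
  simp [valMeasure, Prod.Lex.toLex_lt_toLex]

variable [CommIntegralQuantale Q]

-- The index `p = (x, q)` of the joins and meets below ranges over the pairs in the graph of the
-- function, i.e. `x` ranges over its domain, and `q` is the value of the function at `x`.
mutual
/-- `⟦f ⊆ g⟧`, the meet over `x ∈ dom f` of `f(x) → ⟦x ∈ g⟧`. -/
noncomputable def valSubset (f g : ZFSet.{u}) : Q :=
  ⨅ p : {p : ZFSet.{u} × Q // ZFSet.pair p.1 (c p.2) ∈ f}, p.1.2 ⇨ᵣ valMem p.1.1 g
termination_by valMeasure f g 0
decreasing_by exact valMeasure_lt g 0 0 (rank_lt_of_pair_mem p.2)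

/-- `⟦f = g⟧ = ⟦f ⊆ g⟧ · ⟦g ⊆ f⟧`. -/
noncomputable def valEq (f g : ZFSet.{u}) : Q := valSubset f g * valSubset g f
termination_by valMeasure f g 1
decreasing_by
  · exact valMeasure_lt_tag f g
  · rw [valMeasure_comm f g]
    exact valMeasure_lt_tag g f

/-- `⟦f ∈ g⟧`, the join over `x ∈ dom g` of `g(x) · ⟦x = f⟧`. -/
noncomputable def valMem (f g : ZFSet.{u}) : Q :=
  ⨆ p : {p : ZFSet.{u} × Q // ZFSet.pair p.1 (c p.2) ∈ g}, p.1.2 * valEq p.1.1 f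
termination_by valMeasure f g 0
decreasing_by
  rw [valMeasure_comm f g]
  exact valMeasure_lt f 1 0 (rank_lt_of_pair_mem p.2)
end

/-- `⟦φ(a)⟧_M`, the truth value of `φ(a)` in the `Q`-valued structure given by a subclass `M` of
the valued universe: `=` and `∈` are interpreted as in the valued universe, and the quantifiers
range over `M`. -/
noncomputable def truthValue (M : Set ZFSet.{u}) :
    {n : ℕ} → SetFormula n → (Fin n → ZFSet.{u}) → Q
  | _, .falsum, _ => ⊥
  | _, .eq i j, a => valEq c (a i) (a j)
  | _, .mem i j, a => valMem c (a i) (a j)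
  | _, .and φ ψ, a => truthValue M φ a ⊓ truthValue M ψ a
  | _, .or φ ψ, a => truthValue M φ a ⊔ truthValue M ψ a
  | _, .imp φ ψ, a => truthValue M φ a ⇨ᵣ truthValue M ψ a
  | _, .all φ, a => ⨅ x : M, truthValue M φ (Fin.cons (x : ZFSet.{u}) a)
  | _, .ex φ, a => ⨆ x : M, truthValue M φ (Fin.cons (x : ZFSet.{u}) a)

/-! ## The valued constructible universe -/

/-- `Def^Q(M)`: the functions `f` in the valued universe with `dom f = M` for which there are a
formula `φ` and parameters `b` from `M` with `f(x) = ⟦φ(x, b)⟧_M` for all `x ∈ dom f`. -/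
def valuedDefinableSubsets (M : Set ZFSet.{u}) : Set ZFSet.{u} :=
  {f | f ∈ valuedUniverse c ∧ funDomain f = M ∧
    ∃ (n : ℕ) (φ : SetFormula (n + 1)) (b : Fin n → ZFSet.{u}), (∀ i, b i ∈ M) ∧
      ∀ x ∈ funDomain f, ZFSet.pair x (c (truthValue c M φ (Fin.cons x b))) ∈ f}

/-- The levels of the valued constructible hierarchy: `𝕃_0 = ∅`,
`𝕃_{α+1} = Def^Q(𝕃_α) ∪ 𝕃_α`, and unions at limits. -/
noncomputable def valuedConstructibleLevel (α : Ordinal.{u}) : Set ZFSet.{u} :=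
  Ordinal.limitRecOn (motive := fun _ => Set ZFSet.{u}) α ∅
    (fun _ M => valuedDefinableSubsets c M ∪ M)
    (fun α _ M => ⋃ (β : Ordinal.{u}) (h : β < α), M β h)

/-- The valued constructible universe `𝕃^Q`. -/
noncomputable def valuedConstructibleUniverse : Set ZFSet.{u} :=
  ⋃ α : Ordinal.{u}, valuedConstructibleLevel c α

end Valued

/-!
The valued constructible universe contains no truth value other than `0` and `1`: an element of
`𝕃^Q` is a function whose values are computed from truth values of elements constructed before it,
and the meets, joins, products and residuals of `0` and `1` are again `0` or `1`. So every element
is *hereditarily crisp* (`HereditarilyCrisp`), and is a code of an ordinary set, its collapse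
`collapse f = {collapse x | f(x) = 1}`.

On hereditarily crisp functions the valued equality and membership are the characteristic functions
of equality and membership of the collapses (`valEq_eq_crispValue`, `valMem_eq_crispValue`), hence
the truth value of a formula over a class `M` of such functions is the characteristic function of
satisfaction in the class of collapses of `M` (`truthValue_eq_crispValue`). By induction on `α` this
gives that `𝕃^Q_α` is hereditarily crisp and that the collapse maps it onto `L_α`
(`valuedConstructibleLevel_crisp`).
The function `j` is a section of the collapse that picks, for each `X`, a code in `𝕃^Q_α`
for the least `α` with `X ∈ L_α`.
-/

/-! ### Cumulative hierarchies -/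

/-- A hierarchy with unions at limits that grows at successors is monotone. -/
theorem monotone_of_hierarchy {H : Ordinal.{u} → Set ZFSet.{u}} (hsucc : ∀ α, H α ⊆ H (α + 1))
    (hlim : ∀ α, Order.IsSuccLimit α → H α = ⋃ (β : Ordinal.{u}) (_ : β < α), H β) :
    Monotone H := by
  intro α β hαβ
  induction β using Ordinal.limitRecOn with
  | zero => rw [le_antisymm hαβ (zero_le (a := α))]
  | add_one β ih =>
    rcases hαβ.eq_or_lt with rfl | h
    · exact le_rfl
    · exact (ih (Order.lt_add_one_iff.mp h)).trans (hsucc β)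
  | limit β hβ _ =>
    rcases hαβ.eq_or_lt with rfl | h
    · exact le_rfl
    · rw [hlim β hβ]
      exact Set.subset_biUnion_of_mem (u := H) h

theorem constructibleLevel_zero : constructibleLevel.{u} 0 = ∅ :=
  Ordinal.limitRecOn_zero ..

theorem constructibleLevel_add_one (α : Ordinal.{u}) :
    constructibleLevel (α + 1) = definableSubsets (constructibleLevel α) :=
  Ordinal.limitRecOn_add_one ..

theorem constructibleLevel_limit {α : Ordinal.{u}} (hα : Order.IsSuccLimit α) :
    constructibleLevel α = ⋃ (β : Ordinal.{u}) (_ : β < α), constructibleLevel β :=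
  Ordinal.limitRecOn_limit _ _ _ _ hα

/-- A subset of `M` that is an element of `M` is definable over `M`, by `z ∈ x`. -/
theorem mem_definableSubsets {M : Set ZFSet.{u}} {x : ZFSet.{u}} (hx : x ∈ M)
    (hsub : ∀ z ∈ x, z ∈ M) : x ∈ definableSubsets M := by
  refine ⟨1, .mem 0 1, fun _ => x, fun _ => hx, fun z => ?_⟩
  simp only [Satisfies, Fin.cons_zero, Fin.cons_one]
  exact ⟨fun h => ⟨hsub z h, h⟩, fun h => h.2⟩

theorem constructibleLevel_transitive (α : Ordinal.{u}) :
    ∀ x ∈ constructibleLevel α, ∀ z ∈ x, z ∈ constructibleLevel α := by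
  induction α using Ordinal.limitRecOn with
  | zero => simp [constructibleLevel_zero]
  | add_one α ih =>
    rw [constructibleLevel_add_one]
    rintro x ⟨n, φ, b, -, hx⟩ z hz
    have hzα := ((hx z).mp hz).1
    exact mem_definableSubsets hzα (ih z hzα)
  | limit α hα ih =>
    rw [constructibleLevel_limit hα]
    simp only [Set.mem_iUnion]
    rintro x ⟨β, hβ, hx⟩ z hz
    exact ⟨β, hβ, ih β hβ x hx z hz⟩

theorem constructibleLevel_subset_add_one (α : Ordinal.{u}) :
    constructibleLevel α ⊆ constructibleLevel (α + 1) := by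
  rw [constructibleLevel_add_one]
  exact fun x hx => mem_definableSubsets hx (constructibleLevel_transitive α x hx)

section Hierarchies

variable {Q : Type u} (c : Q ↪ ZFSet.{u})

theorem valuedLevel_zero : valuedLevel c 0 = ∅ :=
  Ordinal.limitRecOn_zero ..

theorem valuedLevel_add_one (α : Ordinal.{u}) :
    valuedLevel c (α + 1) = {f | ∃ d : ZFSet.{u}, (∀ x ∈ d, x ∈ valuedLevel c α) ∧
      ZFSet.IsFunc d (truthValues c) f} :=
  Ordinal.limitRecOn_add_one ..

theorem valuedLevel_limit {α : Ordinal.{u}} (hα : Order.IsSuccLimit α) :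
    valuedLevel c α = ⋃ (β : Ordinal.{u}) (_ : β < α), valuedLevel c β :=
  Ordinal.limitRecOn_limit _ _ _ _ hα

theorem valuedLevel_subset_add_one (α : Ordinal.{u}) :
    valuedLevel c α ⊆ valuedLevel c (α + 1) := by
  induction α using Ordinal.limitRecOn with
  | zero => simp [valuedLevel_zero]
  | add_one α ih =>
    rw [valuedLevel_add_one c (α + 1)]
    rw [valuedLevel_add_one c α] at ih ⊢
    rintro f ⟨d, hd, hf⟩
    exact ⟨d, fun x hx => ih (hd x hx), hf⟩
  | limit α hα ih =>
    intro f hf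
    have hf' := hf
    rw [valuedLevel_limit c hα] at hf'
    simp only [Set.mem_iUnion] at hf'
    obtain ⟨β, hβ, hfβ⟩ := hf'
    have h := ih β hβ hfβ
    rw [valuedLevel_add_one] at h ⊢
    obtain ⟨d, hd, hfd⟩ := h
    refine ⟨d, fun x hx => ?_, hfd⟩
    rw [valuedLevel_limit c hα]
    exact Set.mem_biUnion (t := valuedLevel c) hβ (hd x hx)

theorem isFunc_of_mem_valuedUniverse {f : ZFSet.{u}} (hf : f ∈ valuedUniverse c) :
    ∃ d : ZFSet.{u}, ZFSet.IsFunc d (truthValues c) f := by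
  obtain ⟨α, hα⟩ := Set.mem_iUnion.mp hf
  have h := valuedLevel_subset_add_one c α hα
  rw [valuedLevel_add_one] at h
  obtain ⟨d, -, h⟩ := h
  exact ⟨d, h⟩

variable {c} in
theorem mem_funDomain_iff {d f : ZFSet.{u}} (hf : ZFSet.IsFunc d (truthValues c) f)
    (x : ZFSet.{u}) : x ∈ funDomain f ↔ x ∈ d :=
  ⟨fun ⟨_, hy⟩ => (ZFSet.pair_mem_prod.mp (hf.1 hy)).1, fun hx => (hf.2 x hx).exists⟩

variable {c} in
/-- The values of a function in the valued universe are unique. -/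
theorem value_unique {f x : ZFSet.{u}} (hf : f ∈ valuedUniverse c) {q r : Q}
    (hq : ZFSet.pair x (c q) ∈ f) (hr : ZFSet.pair x (c r) ∈ f) : q = r := by
  obtain ⟨d, hd⟩ := isFunc_of_mem_valuedUniverse c hf
  exact c.injective ((hd.2 x ((mem_funDomain_iff hd x).mp ⟨_, hq⟩)).unique hq hr)

/-- Each level of the valued universe is a set. -/
theorem small_valuedLevel (α : Ordinal.{u}) : Small.{u} (valuedLevel c α) := by
  induction α using Ordinal.limitRecOn with
  | zero => rw [valuedLevel_zero]; infer_instance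
  | add_one α ih =>
    have hsub : valuedLevel c (α + 1) ⊆ ((ZFSet.powerset (ZFSet.prod
        (ZFSet.range (fun x : valuedLevel c α => (x : ZFSet.{u}))) (truthValues c)) : ZFSet.{u}) :
          Set ZFSet.{u}) := by
      rw [valuedLevel_add_one]
      rintro f ⟨d, hd, hf⟩
      rw [SetLike.mem_coe, ZFSet.mem_powerset]
      intro p hp
      obtain ⟨x, hx, y, hy, rfl⟩ := ZFSet.mem_prod.mp (hf.1 hp)
      exact ZFSet.pair_mem_prod.mpr ⟨ZFSet.mem_range.mpr ⟨⟨x, hd x hx⟩, rfl⟩, hy⟩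
    exact @small_subset _ _ _ hsub (ZFSet.small_coe _)
  | limit α hα ih =>
    rw [valuedLevel_limit c hα]
    have (β : Set.Iio α) : Small.{u} (valuedLevel c β) := ih β β.2
    have h : ⋃ (β : Ordinal.{u}) (_ : β < α), valuedLevel c β =
        ⋃ β : Set.Iio α, valuedLevel c β := Set.biUnion_eq_iUnion _ _
    rw [h]
    infer_instance

variable [CommIntegralQuantale Q]

theorem valuedConstructibleLevel_zero : valuedConstructibleLevel c 0 = ∅ :=
  Ordinal.limitRecOn_zero ..

theorem valuedConstructibleLevel_add_one (α : Ordinal.{u}) :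
    valuedConstructibleLevel c (α + 1) =
      valuedDefinableSubsets c (valuedConstructibleLevel c α) ∪ valuedConstructibleLevel c α :=
  Ordinal.limitRecOn_add_one ..

theorem valuedConstructibleLevel_limit {α : Ordinal.{u}} (hα : Order.IsSuccLimit α) :
    valuedConstructibleLevel c α =
      ⋃ (β : Ordinal.{u}) (_ : β < α), valuedConstructibleLevel c β :=
  Ordinal.limitRecOn_limit _ _ _ _ hα

theorem valuedConstructibleLevel_mono : Monotone (valuedConstructibleLevel c) :=
  monotone_of_hierarchy
    (fun α => by rw [valuedConstructibleLevel_add_one]; exact Set.subset_union_right)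
    (fun _ => valuedConstructibleLevel_limit c)

theorem valuedConstructibleLevel_subset_valuedLevel (α : Ordinal.{u}) :
    valuedConstructibleLevel c α ⊆ valuedLevel c α := by
  induction α using Ordinal.limitRecOn with
  | zero => simp [valuedConstructibleLevel_zero]
  | add_one α ih =>
    rw [valuedConstructibleLevel_add_one]
    rintro f (⟨hfV, hdom, -⟩ | hf)
    · obtain ⟨d, hd⟩ := isFunc_of_mem_valuedUniverse c hfV
      rw [valuedLevel_add_one]
      refine ⟨d, fun x hx => ih ?_, hd⟩
      rw [← hdom]
      exact (mem_funDomain_iff hd x).mpr hx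
    · exact valuedLevel_subset_add_one c α (ih hf)
  | limit α hα ih =>
    rw [valuedConstructibleLevel_limit c hα, valuedLevel_limit c hα]
    exact Set.iUnion₂_mono ih

end Hierarchies

/-! ### Two-valued elements of a quantale -/

section CrispValue

variable {Q : Type u} [CommIntegralQuantale Q]

open Classical in
/-- The truth value `1` or `0` of a classical proposition. -/
noncomputable def crispValue (p : Prop) : Q := if p then 1 else ⊥

theorem crispValue_true {p : Prop} (h : p) : (crispValue p : Q) = 1 := if_pos h

theorem crispValue_false {p : Prop} (h : ¬p) : (crispValue p : Q) = ⊥ := if_neg h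

theorem crispValue_eq_one_iff [Nontrivial Q] (p : Prop) : (crispValue p : Q) = 1 ↔ p := by
  by_cases h : p
  · exact iff_of_true (crispValue_true h) h
  · rw [crispValue_false h, CommIntegralQuantale.one_eq_top]
    exact iff_of_false bot_ne_top h

theorem crispValue_and (p q : Prop) :
    (crispValue (p ∧ q) : Q) = crispValue p ⊓ crispValue q := by
  by_cases hp : p <;> by_cases hq : q <;>
    simp [crispValue, hp, hq, CommIntegralQuantale.one_eq_top]

theorem crispValue_or (p q : Prop) :
    (crispValue (p ∨ q) : Q) = crispValue p ⊔ crispValue q := by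
  by_cases hp : p <;> by_cases hq : q <;>
    simp [crispValue, hp, hq, CommIntegralQuantale.one_eq_top]

theorem crispValue_mul (p q : Prop) :
    (crispValue p * crispValue q : Q) = crispValue (p ∧ q) := by
  by_cases hp : p <;> by_cases hq : q <;> simp [crispValue, hp, hq]

theorem crispValue_residuation (p q : Prop) :
    (crispValue p ⇨ᵣ crispValue q : Q) = crispValue (p → q) := by
  refine eq_of_forall_le_iff fun z => ?_
  rw [rightMulResiduation_le_iff_mul_le]
  by_cases hp : p <;> by_cases hq : q <;>
    simp [crispValue, hp, hq, CommIntegralQuantale.one_eq_top (Q := Q) ▸ le_top (a := z),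
      CommIntegralQuantale.one_eq_top (Q := Q) ▸ le_top (a := (⊥ : Q))]

theorem crispValue_iInf {ι : Sort*} (p : ι → Prop) :
    (⨅ i, crispValue (p i) : Q) = crispValue (∀ i, p i) := by
  by_cases h : ∀ i, p i
  · simp [crispValue, h, CommIntegralQuantale.one_eq_top]
  · rw [crispValue_false h]
    obtain ⟨i, hi⟩ := not_forall.mp h
    exact le_bot_iff.mp ((iInf_le _ i).trans (crispValue_false hi).le)

theorem crispValue_iSup {ι : Sort*} (p : ι → Prop) :
    (⨆ i, crispValue (p i) : Q) = crispValue (∃ i, p i) := by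
  by_cases h : ∃ i, p i
  · rw [crispValue_true h]
    obtain ⟨i, hi⟩ := h
    refine le_antisymm ?_ ((crispValue_true hi).ge.trans
      (le_iSup (fun i => (crispValue (p i) : Q)) i))
    rw [CommIntegralQuantale.one_eq_top]
    exact le_top
  · rw [crispValue_false h]
    simp [fun i => crispValue_false (Q := Q) (not_exists.mp h i)]

end CrispValue

/-! ### Hereditarily crisp functions and their collapse -/

section Crisp

variable {Q : Type u} (c : Q ↪ ZFSet.{u}) [CommIntegralQuantale Q]

/-- A function is hereditarily crisp if its only values are `0` and `1`, and the elements of its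
domain are hereditarily crisp. -/
inductive HereditarilyCrisp : ZFSet.{u} → Prop
  | mk (f : ZFSet.{u}) (hval : ∀ x q, ZFSet.pair x (c q) ∈ f → q = 1 ∨ q = ⊥)
      (hdom : ∀ x q, ZFSet.pair x (c q) ∈ f → HereditarilyCrisp x) : HereditarilyCrisp f

variable {c} in
theorem HereditarilyCrisp.eq_one_or_eq_bot {f : ZFSet.{u}} (hf : HereditarilyCrisp c f)
    {x : ZFSet.{u}} {q : Q} (h : ZFSet.pair x (c q) ∈ f) : q = 1 ∨ q = ⊥ := by
  cases hf with | mk _ hval _ => exact hval x q h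

variable {c} in
theorem HereditarilyCrisp.of_pair_mem {f : ZFSet.{u}} (hf : HereditarilyCrisp c f)
    {x : ZFSet.{u}} {q : Q} (h : ZFSet.pair x (c q) ∈ f) : HereditarilyCrisp c x := by
  cases hf with | mk _ _ hdom => exact hdom x q h

variable {c} in
theorem HereditarilyCrisp.eq_crispValue {f : ZFSet.{u}} (hf : HereditarilyCrisp c f)
    {x : ZFSet.{u}} {q : Q} (h : ZFSet.pair x (c q) ∈ f) : q = crispValue (q = 1) := by
  by_cases hq : q = 1
  · rw [crispValue_true hq, hq]
  · rw [crispValue_false hq]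
    exact (hf.eq_one_or_eq_bot h).resolve_left hq

instance small_pair_mem (f y : ZFSet.{u}) : Small.{u} {x : ZFSet.{u} // ZFSet.pair x y ∈ f} := by
  have hsub : {x : ZFSet.{u} | ZFSet.pair x y ∈ f} ⊆
      ((ZFSet.sUnion (ZFSet.sUnion f) : ZFSet.{u}) : Set ZFSet.{u}) := by
    intro x hx
    simp only [SetLike.mem_coe, ZFSet.mem_sUnion]
    exact ⟨{x}, ⟨ZFSet.pair x y, hx, by simp [ZFSet.pair]⟩, by simp⟩
  exact @small_subset _ _ _ hsub (ZFSet.small_coe _)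

/-- The set coded by a function: `collapse f = {collapse x | f(x) = 1}`. -/
noncomputable def collapse (f : ZFSet.{u}) : ZFSet.{u} :=
  ZFSet.range fun x : {x : ZFSet.{u} // ZFSet.pair x (c 1) ∈ f} => collapse x
termination_by f.rank
decreasing_by exact rank_lt_of_pair_mem x.2

theorem mem_collapse {f Z : ZFSet.{u}} :
    Z ∈ collapse c f ↔ ∃ x, ZFSet.pair x (c 1) ∈ f ∧ collapse c x = Z := by
  rw [collapse, ZFSet.mem_range]
  simp only [Subtype.exists, exists_prop]

mutual
theorem valSubset_eq_crispValue {f g : ZFSet.{u}} (hf : HereditarilyCrisp c f)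
    (hg : HereditarilyCrisp c g) :
    valSubset c f g = crispValue (collapse c f ⊆ collapse c g) := by
  have h (p : {p : ZFSet.{u} × Q // ZFSet.pair p.1 (c p.2) ∈ f}) :
      (p.1.2 ⇨ᵣ valMem c p.1.1 g) =
        crispValue (p.1.2 = 1 → collapse c p.1.1 ∈ collapse c g) := by
    rw [valMem_eq_crispValue (hf.of_pair_mem p.2) hg, ← crispValue_residuation,
      ← hf.eq_crispValue p.2]
  rw [valSubset, iInf_congr h, crispValue_iInf]
  congr 1
  refine propext ⟨fun H Z hZ => ?_, fun H p hp => H ?_⟩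
  · obtain ⟨x, hx, rfl⟩ := (mem_collapse c).mp hZ
    exact H ⟨(x, 1), hx⟩ rfl
  · exact (mem_collapse c).mpr ⟨p.1.1, hp ▸ p.2, rfl⟩
termination_by valMeasure f g 0
decreasing_by exact valMeasure_lt g 0 0 (rank_lt_of_pair_mem p.2)

theorem valEq_eq_crispValue {f g : ZFSet.{u}} (hf : HereditarilyCrisp c f)
    (hg : HereditarilyCrisp c g) : valEq c f g = crispValue (collapse c f = collapse c g) := by
  rw [valEq, valSubset_eq_crispValue hf hg, valSubset_eq_crispValue hg hf, crispValue_mul]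
  congr 1
  exact propext ⟨fun h => subset_antisymm h.1 h.2, fun h => ⟨h.subset, h.superset⟩⟩
termination_by valMeasure f g 1
decreasing_by
  · exact valMeasure_lt_tag f g
  · rw [valMeasure_comm f g]
    exact valMeasure_lt_tag g f

theorem valMem_eq_crispValue {f g : ZFSet.{u}} (hf : HereditarilyCrisp c f)
    (hg : HereditarilyCrisp c g) : valMem c f g = crispValue (collapse c f ∈ collapse c g) := by
  have h (p : {p : ZFSet.{u} × Q // ZFSet.pair p.1 (c p.2) ∈ g}) :
      p.1.2 * valEq c p.1.1 f = crispValue (p.1.2 = 1 ∧ collapse c p.1.1 = collapse c f) := by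
    rw [valEq_eq_crispValue (hg.of_pair_mem p.2) hf, ← crispValue_mul, ← hg.eq_crispValue p.2]
  rw [valMem, iSup_congr h, crispValue_iSup]
  congr 1
  rw [mem_collapse]
  refine propext ⟨fun ⟨p, hp, hpf⟩ => ⟨p.1.1, hp ▸ p.2, hpf⟩, fun ⟨x, hx, hxf⟩ => ?_⟩
  exact ⟨⟨(x, 1), hx⟩, rfl, hxf⟩
termination_by valMeasure f g 0
decreasing_by
  rw [valMeasure_comm f g]
  exact valMeasure_lt f 1 0 (rank_lt_of_pair_mem p.2)
end

theorem collapse_cons {n : ℕ} (x : ZFSet.{u}) (a : Fin n → ZFSet.{u}) :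
    (fun i => collapse c ((Fin.cons x a : Fin (n + 1) → ZFSet.{u}) i)) =
      Fin.cons (collapse c x) fun i => collapse c (a i) := by
  funext i
  cases i using Fin.cases <;> rfl

/-- Over hereditarily crisp functions, the truth value of a formula is `1` or `0` according to
whether the formula is satisfied in the class of the coded sets. -/
theorem truthValue_eq_crispValue {M : Set ZFSet.{u}} (hM : ∀ f ∈ M, HereditarilyCrisp c f)
    {n : ℕ} (φ : SetFormula n) (a : Fin n → ZFSet.{u}) (ha : ∀ i, a i ∈ M) :
    truthValue c M φ a =
      crispValue (Satisfies (collapse c '' M) φ fun i => collapse c (a i)) := by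
  have hcons {n : ℕ} {a : Fin n → ZFSet.{u}} (ha : ∀ i, a i ∈ M) (x : M) (i : Fin (n + 1)) :
      (Fin.cons (x : ZFSet.{u}) a : Fin (n + 1) → ZFSet.{u}) i ∈ M := by
    cases i using Fin.cases with
    | zero => exact x.2
    | succ i => exact ha i
  induction φ with
  | falsum => exact (crispValue_false not_false).symm
  | eq i j => exact valEq_eq_crispValue c (hM _ (ha i)) (hM _ (ha j))
  | mem i j => exact valMem_eq_crispValue c (hM _ (ha i)) (hM _ (ha j))
  | and φ ψ ihφ ihψ => simp only [truthValue, Satisfies, ihφ a ha, ihψ a ha, crispValue_and]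
  | or φ ψ ihφ ihψ => simp only [truthValue, Satisfies, ihφ a ha, ihψ a ha, crispValue_or]
  | imp φ ψ ihφ ihψ =>
    simp only [truthValue, Satisfies, ihφ a ha, ihψ a ha, crispValue_residuation]
  | all φ ih =>
    simp only [truthValue, Satisfies, ih _ (hcons ha _), crispValue_iInf, collapse_cons,
      Set.forall_mem_image, Subtype.forall]
  | ex φ ih =>
    simp only [truthValue, Satisfies, ih _ (hcons ha _), crispValue_iSup, collapse_cons,
      Set.exists_mem_image, Subtype.exists, exists_prop]

section Definable

variable {c} {M : Set ZFSet.{u}} (hM : ∀ f ∈ M, HereditarilyCrisp c f) {f : ZFSet.{u}}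
  (hfV : f ∈ valuedUniverse c) (hdom : funDomain f = M) {n : ℕ} {φ : SetFormula (n + 1)}
  {b : Fin n → ZFSet.{u}} (hb : ∀ i, b i ∈ M)
  (hval : ∀ x ∈ funDomain f, ZFSet.pair x (c (truthValue c M φ (Fin.cons x b))) ∈ f)
include hM hfV hdom hb hval

/-- The values of a function that is definable over a hereditarily crisp class. -/
theorem eq_crispValue_of_pair_mem {x : ZFSet.{u}} {q : Q} (h : ZFSet.pair x (c q) ∈ f) :
    q = crispValue (Satisfies (collapse c '' M) φ
      (Fin.cons (collapse c x) fun i => collapse c (b i))) := by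
  have hx : x ∈ funDomain f := ⟨_, h⟩
  rw [value_unique hfV h (hval x hx), truthValue_eq_crispValue c hM, collapse_cons]
  intro i
  cases i using Fin.cases with
  | zero => exact hdom ▸ hx
  | succ i => exact hb i

theorem hereditarilyCrisp_of_definable : HereditarilyCrisp c f := by
  refine .mk f (fun x q h => ?_) fun x q h => hM x (hdom ▸ ⟨_, h⟩)
  rw [eq_crispValue_of_pair_mem hM hfV hdom hb hval h]
  exact (em _).imp crispValue_true crispValue_false

/-- A function defined by a formula over a hereditarily crisp class codes the set which the same
formula defines over the collapses. -/
theorem mem_collapse_of_definable [Nontrivial Q] (z : ZFSet.{u}) :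
    z ∈ collapse c f ↔ z ∈ collapse c '' M ∧
      Satisfies (collapse c '' M) φ (Fin.cons z fun i => collapse c (b i)) := by
  rw [mem_collapse]
  constructor
  · rintro ⟨x, hx, rfl⟩
    exact ⟨⟨x, hdom ▸ ⟨_, hx⟩, rfl⟩, (crispValue_eq_one_iff _).mp
      (eq_crispValue_of_pair_mem hM hfV hdom hb hval hx).symm⟩
  · rintro ⟨⟨x, hx, rfl⟩, hφ⟩
    have h := hval x (hdom ▸ hx)
    rw [eq_crispValue_of_pair_mem hM hfV hdom hb hval h, crispValue_true hφ] at h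
    exact ⟨x, h, rfl⟩

end Definable

variable {c} in
/-- Over a subset of a level of the valued universe, each formula with parameters defines
a function. -/
theorem exists_valuedDefinable {M : Set ZFSet.{u}} {α : Ordinal.{u}} (hM : M ⊆ valuedLevel c α)
    {n : ℕ} (φ : SetFormula (n + 1)) (b : Fin n → ZFSet.{u}) :
    ∃ f ∈ valuedUniverse c, funDomain f = M ∧
      ∀ x ∈ funDomain f, ZFSet.pair x (c (truthValue c M φ (Fin.cons x b))) ∈ f := by
  have : Small.{u} (valuedLevel c α) := small_valuedLevel c α
  have : Small.{u} M := small_subset hM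
  let v (x : ZFSet.{u}) : ZFSet.{u} := c (truthValue c M φ (Fin.cons x b))
  let f : ZFSet.{u} := ZFSet.range fun x : M => ZFSet.pair x (v x)
  let d : ZFSet.{u} := ZFSet.range fun x : M => (x : ZFSet.{u})
  have mem_f (x y : ZFSet.{u}) : ZFSet.pair x y ∈ f ↔ x ∈ M ∧ v x = y := by
    simp only [f, ZFSet.mem_range, ZFSet.pair_inj, Subtype.exists, exists_prop]
    constructor
    · rintro ⟨x, hx, rfl, h⟩
      exact ⟨hx, h⟩
    · rintro ⟨hx, h⟩
      exact ⟨x, hx, rfl, h⟩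
  have mem_d (x : ZFSet.{u}) : x ∈ d ↔ x ∈ M := by simp [d]
  have hdom : funDomain f = M :=
    Set.ext fun x => ⟨fun ⟨y, hy⟩ => ((mem_f x y).mp hy).1,
      fun hx => ⟨v x, (mem_f x _).mpr ⟨hx, rfl⟩⟩⟩
  refine ⟨f, Set.mem_iUnion.mpr ⟨α + 1, ?_⟩, hdom, fun x hx => (mem_f x _).mpr ⟨hdom ▸ hx, rfl⟩⟩
  rw [valuedLevel_add_one]
  refine ⟨d, fun x hx => hM ((mem_d x).mp hx), fun p hp => ?_, fun x hx => ?_⟩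
  · obtain ⟨x, rfl⟩ := ZFSet.mem_range.mp hp
    exact ZFSet.pair_mem_prod.mpr ⟨(mem_d x).mpr x.2, ZFSet.mem_range_self _⟩
  · exact ⟨v x, (mem_f x _).mpr ⟨(mem_d x).mp hx, rfl⟩, fun y hy => ((mem_f x y).mp hy).2.symm⟩

/-- Each level of the valued constructible hierarchy is hereditarily crisp, and its collapse is the
corresponding level of the constructible hierarchy. -/
theorem valuedConstructibleLevel_crisp [Nontrivial Q] (α : Ordinal.{u}) :
    (∀ f ∈ valuedConstructibleLevel c α, HereditarilyCrisp c f) ∧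
      collapse c '' valuedConstructibleLevel c α = constructibleLevel α := by
  induction α using Ordinal.limitRecOn with
  | zero => simp [valuedConstructibleLevel_zero, constructibleLevel_zero]
  | add_one α ih =>
    obtain ⟨hM, himage⟩ := ih
    rw [valuedConstructibleLevel_add_one]
    refine ⟨?_, Set.Subset.antisymm ?_ ?_⟩
    · rintro f (⟨hfV, hdom, n, φ, b, hb, hval⟩ | hf)
      · exact hereditarilyCrisp_of_definable hM hfV hdom hb hval
      · exact hM f hf
    · rintro _ ⟨f, ⟨hfV, hdom, n, φ, b, hb, hval⟩ | hf, rfl⟩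
      · rw [constructibleLevel_add_one, ← himage]
        exact ⟨n, φ, fun i => collapse c (b i), fun i => Set.mem_image_of_mem _ (hb i),
          mem_collapse_of_definable hM hfV hdom hb hval⟩
      · exact constructibleLevel_subset_add_one α (himage ▸ Set.mem_image_of_mem _ hf)
    · rw [constructibleLevel_add_one, ← himage]
      rintro X ⟨n, φ, b, hb, hX⟩
      choose b' hb' hbb' using hb
      obtain rfl : (fun i => collapse c (b' i)) = b := funext hbb'
      obtain ⟨f, hfV, hdom, hval⟩ := exists_valuedDefinable
        (valuedConstructibleLevel_subset_valuedLevel c α) φ b'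
      refine ⟨f, Or.inl ⟨hfV, hdom, n, φ, b', hb', hval⟩, ZFSet.ext fun z => ?_⟩
      rw [mem_collapse_of_definable hM hfV hdom hb' hval, hX]
  | limit α hα ih =>
    rw [valuedConstructibleLevel_limit c hα, constructibleLevel_limit hα]
    constructor
    · simp only [Set.mem_iUnion]
      rintro f ⟨β, hβ, hf⟩
      exact (ih β hβ).1 f hf
    · rw [Set.image_iUnion₂]
      exact Set.iUnion₂_congr fun β hβ => (ih β hβ).2

end Crisp

theorem mainTheorem1 {Q : Type u} [CommIntegralQuantale Q] [Nontrivial Q] (c : Q ↪ ZFSet.{u}) :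
    ∃ j : (constructibleUniverse.{u} : Set ZFSet.{u}) → valuedConstructibleUniverse c,
      ∀ α : Ordinal.{u},
        (∀ X : (constructibleUniverse.{u} : Set ZFSet.{u}), (X : ZFSet.{u}) ∈ constructibleLevel α →
          (j X : ZFSet.{u}) ∈ valuedConstructibleLevel c α) ∧
        Set.InjOn j {X | (X : ZFSet.{u}) ∈ constructibleLevel α} ∧
        (∀ Y ∈ valuedConstructibleLevel c α, ∃ X : (constructibleUniverse.{u} : Set ZFSet.{u}),
          (X : ZFSet.{u}) ∈ constructibleLevel α ∧
          valEq c (j X : ZFSet.{u}) Y = 1) ∧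
        (∀ (n : ℕ) (φ : SetFormula n) (a : Fin n → (constructibleUniverse.{u} : Set ZFSet.{u})),
          (∀ i, (a i : ZFSet.{u}) ∈ constructibleLevel α) →
          (Satisfies (constructibleLevel α) φ (fun i => (a i : ZFSet.{u})) ↔
            truthValue c (valuedConstructibleLevel c α) φ (fun i => (j (a i) : ZFSet.{u})) = 1)) := by
  have hex (X : (constructibleUniverse.{u} : Set ZFSet.{u})) :
      ∃ f, collapse c f = X ∧ ∀ α, (X : ZFSet.{u}) ∈ constructibleLevel α →
        f ∈ valuedConstructibleLevel c α := by
    have hX : {α : Ordinal.{u} | (X : ZFSet.{u}) ∈ constructibleLevel α}.Nonempty :=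
      Set.mem_iUnion.mp X.2
    -- A code in the first possible level lies in all the later ones.
    have hmin : (X : ZFSet.{u}) ∈ constructibleLevel (sInf _) := csInf_mem hX
    rw [← (valuedConstructibleLevel_crisp c _).2] at hmin
    obtain ⟨f, hf, hfX⟩ := hmin
    exact ⟨f, hfX, fun α hα => valuedConstructibleLevel_mono c (csInf_le' hα) hf⟩
  choose j hcollapse hlevel using hex
  refine ⟨fun X => ⟨j X, ?_⟩, fun α => ⟨fun X hX => hlevel X α hX, ?_, ?_, ?_⟩⟩
  · obtain ⟨α, hα⟩ := Set.mem_iUnion.mp X.2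
    exact Set.mem_iUnion.mpr ⟨α, hlevel X α hα⟩
  · intro X _ Y _ hXY
    exact Subtype.ext ((hcollapse X).symm.trans
      ((congrArg (collapse c) (Subtype.ext_iff.mp hXY)).trans (hcollapse Y)))
  · intro Y hY
    have ⟨hcrisp, himage⟩ := valuedConstructibleLevel_crisp c α
    have hYα : collapse c Y ∈ constructibleLevel α := himage ▸ Set.mem_image_of_mem _ hY
    let X : (constructibleUniverse.{u} : Set ZFSet.{u}) :=
      ⟨collapse c Y, Set.mem_iUnion.mpr ⟨α, hYα⟩⟩
    refine ⟨X, hYα, ?_⟩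
    rw [valEq_eq_crispValue c (hcrisp _ (hlevel X α hYα)) (hcrisp Y hY)]
    exact crispValue_true (hcollapse X)
  · intro n φ a ha
    have ⟨hcrisp, himage⟩ := valuedConstructibleLevel_crisp c α
    rw [truthValue_eq_crispValue c hcrisp φ _ fun i => hlevel (a i) α (ha i), himage,
      crispValue_eq_one_iff]
    simp only [hcollapse]
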